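/- **Theorem 2.2.** Let $Q$ be a finite-dimensional (Hausdorff, boundaryless) smooth manifold, $\tau_Q:TQ\to Q$ its tangent bundle, and let $\Gamma$ be an explicit second order differential equation (SODE) on $Q$, that is, a $C^\infty$ vector field on $TQ$ with $T_v\tau_Q(\Gamma(v))=v$ for all $v\in TQ$ (locally $\Gamma=\dot q^i\,\partial/\partial q^i+\xi^i(q,\dot q)\,\partial/\partial\dot q^i$). A trajectory of $\Gamma$ is a curve in $Q$ whose tangent lift is an integral curve of $\Gamma$. Let $\Phi^\Gamma$ be the flow of $\Gamma$, with domain $D^\Gamma=\{(t,v)\in\mathbb R\times TQ : \Phi^\Gamma(\cdot,v)\text{ is defined at least on the interval between } 0 \text{ and } t\}$. For $q_0\in Q$ and $h\ge 0$ put $$D^\Gamma_{(h,q_0)}=\{v\in T_{q_0}Q : (h,v)\in D^\Gamma\},\qquad \exp^\Gamma_{(h,q_0)}(v)=(\tau_Q\circ\Phi^\Gamma)(h,v)\quad\text{for } v\in D^\Gamma_{(h,q_0)}.$$ Fix $q_0\in Q$. Call *loop data* at $q_0$ a number $h_0>0$, a family of vectors $v_{(h,q_0)}\in T_{q_0}Q$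 $(0<h\le h_0)$, and compact sets $C\subseteq Q$, $\bar C\subseteq TQ$ with $q_0\in C$ and $v_{(h,q_0)}\in\bar C$ for all $0<h\le h_0$, such that for every $0<h\le h_0$ there is a unique trajectory $\sigma_{q_0q_0h}:[0,h]\to C$ of $\Gamma$ with $\sigma_{q_0q_0h}(0)=\sigma_{q_0q_0h}(h)=q_0$ and $\dot\sigma_{q_0q_0h}(t)\in\bar C$ for all $t\in[0,h]$, and moreover $\dot\sigma_{q_0q_0h}(0)=v_{(h,q_0)}$. Then loop data at $q_0$ exist. Moreover, for any loop data $(h_0,(v_{(h,q_0)})_{0<h\le h_0},C,\bar C)$ at $q_0$ there is $0<h_1\le h_0$ such that for every $0<h\le h_1$: 1. $v_{(h,q_0)}\in D^\Gamma_{(h,q_0)}$ and $\exp^\Gamma_{(h,q_0)}(v_{(h,q_0)})=q_0$; 2. $D^\Gamma_{(h,q_0)}$ is a neighbourhood of $v_{(h,q_0)}$ in $T_{q_0}Q$, the map $\exp^\Gamma_{(h,q_0)}$ is differentiable at $v_{(h,q_0)}$, and its differential $$T_{v_{(h,q_0)}}\exp^\Gamma_{(h,q_0)}:T_{v_{(h,q_0)}}D^\Gamma_{(h,q_0)}\cong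 T_{q_0}Q\longrightarrow T_{q_0}Q$$ is a linear isomorphism. -/

import Mathlib

open Set
open scoped Manifold ContDiff Topology

noncomputable section

namespace SODE

variable {E : Type*} [NormedAddCommGroup E] [NormedSpace ℝ E]
  {Q : Type*} [TopologicalSpace Q] [ChartedSpace E Q] [IsManifold 𝓘(ℝ, E) ∞ Q]

/-- A (not necessarily smooth) vector field on the tangent bundle `TQ`. -/
abbrev TQField (E : Type*) [NormedAddCommGroup E] [NormedSpace ℝ E]
    (Q : Type*) [TopologicalSpace Q] [ChartedSpace E Q] [IsManifold 𝓘(ℝ, E) ∞ Q] :=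
  (p : TangentBundle 𝓘(ℝ, E) Q) → TangentSpace 𝓘(ℝ, E).tangent p

/-- An explicit second order differential equation on `Q`: a smooth vector field `Γ` on `TQ` with
`Tτ (Γ p) = p` for every `p ∈ TQ`, where `τ : TQ → Q` is the projection. In induced coordinates
`(q, q̇)` this says `Γ(q, q̇) = q̇ ∂/∂q + ξ(q, q̇) ∂/∂q̇` with `ξ` smooth. -/
structure IsSODE (Γ : TQField E Q) : Prop where
  smooth : ContMDiff 𝓘(ℝ, E).tangent 𝓘(ℝ, E).tangent.tangent ∞
    (fun p ↦ (⟨p, Γ p⟩ : TangentBundle 𝓘(ℝ, E).tangent (TangentBundle 𝓘(ℝ, E) Q)))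
  second_order : ∀ p : TangentBundle 𝓘(ℝ, E) Q,
    mfderiv 𝓘(ℝ, E).tangent 𝓘(ℝ, E) (fun x : TangentBundle 𝓘(ℝ, E) Q ↦ x.proj) p (Γ p) = p.snd

/-- The tangent lift `t ↦ σ̇(t) ∈ T_{σ(t)}Q` of a curve `σ` defined on `s ⊆ ℝ`
(one-sided derivatives at the ends when `s` is a compact interval). -/
def tangentLift (E : Type*) [NormedAddCommGroup E] [NormedSpace ℝ E]
    {Q : Type*} [TopologicalSpace Q] [ChartedSpace E Q]
    (s : Set ℝ) (σ : ℝ → Q) (t : ℝ) : TangentBundle 𝓘(ℝ, E) Q :=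
  ⟨σ t, mfderivWithin 𝓘(ℝ, ℝ) 𝓘(ℝ, E) σ s t (1 : ℝ)⟩

/-- `σ` is, on `s ⊆ ℝ`, a trajectory of `Γ`: a curve in `Q` whose tangent lift is an
integral curve of `Γ`. The values of `σ` outside `s` are irrelevant. -/
structure IsTrajectoryOn (Γ : TQField E Q) (σ : ℝ → Q) (s : Set ℝ) : Prop where
  mdifferentiableOn : MDifferentiableOn 𝓘(ℝ, ℝ) 𝓘(ℝ, E) σ s
  integralCurve : IsMIntegralCurveOn (tangentLift E s σ) Γ s

/-- The domain `D^Γ ⊆ ℝ × TQ` of the flow of `Γ`: all `(t, p)` such that `t` lies in the maximal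
interval of existence of the integral curve of `Γ` starting at `p`. -/
def flowDomain (Γ : TQField E Q) : Set (ℝ × TangentBundle 𝓘(ℝ, E) Q) :=
  {x | ∃ (γ : ℝ → TangentBundle 𝓘(ℝ, E) Q) (J : Set ℝ), IsOpen J ∧ J.OrdConnected ∧
    0 ∈ J ∧ x.1 ∈ J ∧ γ 0 = x.2 ∧ IsMIntegralCurveOn γ Γ J}

open Classical in
/-- The flow `Φ^Γ` of `Γ`: the value at time `t` of an integral curve starting at `p` (it does not
depend on the curve when `Γ` is smooth and `Q` is Hausdorff); the value off `flowDomain Γ` is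
a dummy. -/
def flow (Γ : TQField E Q) (t : ℝ) (p : TangentBundle 𝓘(ℝ, E) Q) : TangentBundle 𝓘(ℝ, E) Q :=
  if hx : (t, p) ∈ flowDomain Γ then hx.choose t else p

/-- The set `D^Γ_(h, q₀) ⊆ T_{q₀}Q`. -/
def expDomain (Γ : TQField E Q) (h : ℝ) (q₀ : Q) : Set (TangentSpace 𝓘(ℝ, E) q₀) :=
  {v | (h, (⟨q₀, v⟩ : TangentBundle 𝓘(ℝ, E) Q)) ∈ flowDomain Γ}

/-- The exponential map `exp^Γ_(h, q₀) = τ ∘ Φ^Γ(h, ·)`, meaningful on `expDomain Γ h q₀`. -/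
def expMap (Γ : TQField E Q) (h : ℝ) (q₀ : Q) (v : TangentSpace 𝓘(ℝ, E) q₀) : Q :=
  (flow Γ h ⟨q₀, v⟩).proj

/-- `σ : [0, h] → C` is a trajectory of `Γ` with `σ(0) = σ(h) = q₀` and all velocities in `K`. -/
structure IsLoopTrajectory (Γ : TQField E Q) (q₀ : Q) (C : Set Q)
    (K : Set (TangentBundle 𝓘(ℝ, E) Q)) (h : ℝ) (σ : ℝ → Q) : Prop where
  trajectory : IsTrajectoryOn Γ σ (Icc 0 h)
  mapsTo : ∀ t ∈ Icc 0 h, σ t ∈ C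
  start : σ 0 = q₀
  finish : σ h = q₀
  velocity_mem : ∀ t ∈ Icc 0 h, tangentLift E (Icc 0 h) σ t ∈ K

/-- The data attached to `Γ` and `q₀`: a number `h₀ > 0`, vectors `v h ∈ T_{q₀}Q` for
`0 < h ≤ h₀`, and compact sets `C ⊆ Q`, `K ⊆ TQ` with `q₀ ∈ C` and `v h ∈ K`, such that for each
`0 < h ≤ h₀` there is one and only one trajectory `σ : [0, h] → C` of `Γ` with
`σ(0) = σ(h) = q₀` and velocities in `K`, and `v h` is its initial velocity. -/
structure IsLoopFamily (Γ : TQField E Q) (q₀ : Q) (h₀ : ℝ)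
    (v : ℝ → TangentSpace 𝓘(ℝ, E) q₀) (C : Set Q)
    (K : Set (TangentBundle 𝓘(ℝ, E) Q)) : Prop where
  pos : 0 < h₀
  isCompact_base : IsCompact C
  isCompact_velocities : IsCompact K
  base_mem : q₀ ∈ C
  vector_mem : ∀ h ∈ Ioc 0 h₀, (⟨q₀, v h⟩ : TangentBundle 𝓘(ℝ, E) Q) ∈ K
  exists_unique : ∀ h ∈ Ioc 0 h₀, ∃ σ : ℝ → Q,
    IsLoopTrajectory Γ q₀ C K h σ ∧
    tangentLift E (Icc 0 h) σ 0 = ⟨q₀, v h⟩ ∧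
    ∀ σ' : ℝ → Q, IsLoopTrajectory Γ q₀ C K h σ' → EqOn σ' σ (Icc 0 h)

end SODE

end

/-! In a bundle chart at `q₀` the equation reads `(q, v)' = (v, ξ(q, v))`. On a compact product of
balls the field and its derivative are bounded and Lipschitz, so all solutions starting at `(q₀,
w)`, with `w` in a fixed ball, live for a common time. The end position after time `h` is then `q₀ +
h w` up to an error `ρ h`, and its derivative in `w` is within `h / 2` of `h • id`, hence invertible
(`exists_local_flow`). This derivative comes from solving the variational equation and comparing it
with the flow by Gronwall (`norm_sub_linearization_le`).

Existence of loops is a shooting problem: the simplified Newton map `w ↦ w - h⁻¹ (S w - q₀)`, where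
`S w` is the end position, contracts the unit ball, so exactly one `w` there returns to `q₀`
(`exists_unique_preimage_of_fderiv_near_smul_id`). Taking the images of a small position ball and of
its product with the unit velocity ball as the compact sets makes the loop unique, because a
competing trajectory is determined by its initial velocity.

For arbitrary loop data only boundedness of the initial velocities matters: they lie in the compact
set met with one fibre. The uniform derivative estimate then applies to all of them
(`IsSODE.exists_expMap_differential`), and uniqueness of integral curves identifies the given loop
with the flow. -/

namespace SODE

/-! ### Differential equations in a normed space: existence and linearisation. -/

section Analysis

open Metric
open scoped NNReal

variable {V : Type*} [NormedAddCommGroup V] [NormedSpace ℝ V]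

/-- Picard–Lindelöf on `(-T, T)`, keeping track of the ball which contains the solution. -/
theorem exists_solution_mem_closedBall [CompleteSpace V] {f : ℝ → V → V} {x : V} {a M K : ℝ≥0}
    {T : ℝ} (hT : 0 ≤ T)
    (hlip : ∀ t ∈ Icc (-T) T, LipschitzOnWith K (f t) (closedBall x a))
    (hcont : ∀ y ∈ closedBall x a, ContinuousOn (f · y) (Icc (-T) T))
    (hM : ∀ t ∈ Icc (-T) T, ∀ y ∈ closedBall x a, ‖f t y‖ ≤ M) (hMT : M * T ≤ a) :
    ∃ α : ℝ → V, α 0 = x ∧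
      ∀ t ∈ Ioo (-T) T, α t ∈ closedBall x a ∧ HasDerivAt α (f t (α t)) t := by
  have h0 : (0 : ℝ) ∈ Icc (-T) T := ⟨by linarith, hT⟩
  -- The radius `0` restricts the initial values to the centre `x`, leaving the whole radius `a` for
  -- the motion.
  have hf : IsPicardLindelof f (⟨0, h0⟩ : Icc (-T) T) x a 0 M K :=
    { lipschitzOnWith := hlip
      continuousOn := hcont
      norm_le := hM
      mul_max_le := by simpa using hMT }
  have hx : x ∈ closedBall x ((0 : ℝ≥0) : ℝ) := mem_closedBall_self le_rfl
  -- The fixed point of the Picard operator is used directly because its function space records that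
  -- the values stay in the ball.
  obtain ⟨α, hα⟩ := ODE.FunSpace.exists_isFixedPt_next hf hx
  refine ⟨α.compProj, ?_, fun t ht ↦ ⟨α.compProj_mem_closedBall hf.mul_max_le, ?_⟩⟩
  · have := ODE.FunSpace.compProj_val (α := α) (t := ⟨0, h0⟩)
    rw [this, ← hα, ODE.FunSpace.next_apply₀]
  · have ht' : t ∈ Icc (-T) T := Ioo_subset_Icc_self ht
    refine HasDerivWithinAt.hasDerivAt (s := Icc (-T) T) ?_ (Icc_mem_nhds ht.1 ht.2)
    apply ODE.hasDerivWithinAt_picard_Icc h0 hf.continuousOn_uncurry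
      α.continuous_compProj.continuousOn (fun _ _ ↦ α.compProj_mem_closedBall hf.mul_max_le)
      x ht' |>.congr_of_mem _ ht'
    intro t' ht'
    nth_rw 1 [← hα]
    rw [ODE.FunSpace.compProj_of_mem ht', ODE.FunSpace.next_apply]

/-- A linear differential equation `A' = D(t) ∘ A` on a short time interval. -/
theorem exists_linear_solution {E : Type*} [NormedAddCommGroup E] [NormedSpace ℝ E]
    [CompleteSpace V] {D : ℝ → V →L[ℝ] V} {A₀ : E →L[ℝ] V} {K : ℝ≥0} {T : ℝ} (hT : 0 ≤ T)
    (hA₀ : ‖A₀‖ ≤ 1) (hD : ContinuousOn D (Icc (-T) T)) (hK : ∀ t ∈ Icc (-T) T, ‖D t‖ ≤ K)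
    (hKT : 2 * K * T ≤ 1) :
    ∃ A : ℝ → E →L[ℝ] V, A 0 = A₀ ∧
      ∀ t ∈ Ioo (-T) T, ‖A t‖ ≤ 2 ∧ HasDerivAt A (D t ∘L A t) t := by
  have hball : ∀ B ∈ closedBall A₀ ((1 : ℝ≥0) : ℝ), ‖B‖ ≤ 2 := fun B hB ↦ by
    rw [mem_closedBall_iff_norm] at hB
    calc ‖B‖ = ‖A₀ + (B - A₀)‖ := by rw [add_sub_cancel]
      _ ≤ ‖A₀‖ + ‖B - A₀‖ := norm_add_le _ _
      _ ≤ 2 := by norm_num at hB; linarith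
  -- On the unit ball around `A₀` operators have norm at most `2`, so the field is bounded by `2 *
  -- K`.
  obtain ⟨A, h0, hA⟩ := exists_solution_mem_closedBall (f := fun t (B : E →L[ℝ] V) ↦ D t ∘L B)
    (x := A₀) (a := 1) (M := 2 * K) (K := K) hT
    (fun t ht ↦ LipschitzOnWith.of_dist_le_mul fun B _ B' _ ↦ by
      rw [dist_eq_norm, dist_eq_norm, ← ContinuousLinearMap.comp_sub]
      exact (ContinuousLinearMap.opNorm_comp_le _ _).trans (by gcongr; exact hK t ht))
    (fun B _ ↦ hD.clm_comp continuousOn_const)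
    (fun t ht B hB ↦ (ContinuousLinearMap.opNorm_comp_le _ _).trans (by
      have := mul_le_mul (hK t ht) (hball B hB) (norm_nonneg _) K.2
      push_cast; linarith))
    (by push_cast; exact hKT)
  exact ⟨A, h0, fun t ht ↦ ⟨hball _ (hA t ht).1, (hA t ht).2⟩⟩

/-- First order Taylor estimate on a convex set on which the derivative is Lipschitz. -/
theorem norm_taylor_remainder_le {f : V → V} {D : V → V →L[ℝ] V} {S : Set V} {K : ℝ≥0}
    (hS : Convex ℝ S) (hf : ∀ z ∈ S, HasFDerivWithinAt f (D z) S z) (hD : LipschitzOnWith K D S)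
    {x y : V} (hx : x ∈ S) (hy : y ∈ S) :
    ‖f y - f x - D x (y - x)‖ ≤ K * ‖y - x‖ * ‖y - x‖ := by
  -- Cutting `S` down to the ball of radius `‖y - x‖` bounds `‖D z - D x‖` by `K * ‖y - x‖`.
  refine Convex.norm_image_sub_le_of_norm_hasFDerivWithin_le' (s := S ∩ closedBall x ‖y - x‖)
    (f' := D) (fun z hz ↦ (hf z hz.1).mono inter_subset_left) (fun z hz ↦ ?_)
    (hS.inter (convex_closedBall _ _)) ⟨hx, mem_closedBall_self (norm_nonneg _)⟩
    ⟨hy, by rw [mem_closedBall_iff_norm]⟩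
  rw [← dist_eq_norm]
  refine (hD.dist_le_mul z hz.1 x hx).trans ?_
  gcongr
  exact hz.2

/-- The linearised flow approximates the flow to second order in the initial value. -/
theorem norm_sub_linearization_le {f : V → V} {D : V → V →L[ℝ] V} {S : Set V} {K K' : ℝ≥0}
    (hS : Convex ℝ S) (hf : ∀ z ∈ S, HasFDerivWithinAt f (D z) S z)
    (hlip : LipschitzOnWith K f S) (hDK : ∀ z ∈ S, ‖D z‖ ≤ K) (hD : LipschitzOnWith K' D S)
    {x y u : ℝ → V} {h : ℝ}
    (hx : ∀ t ∈ Icc 0 h, x t ∈ S ∧ HasDerivAt x (f (x t)) t)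
    (hy : ∀ t ∈ Icc 0 h, y t ∈ S ∧ HasDerivAt y (f (y t)) t)
    (hu : ∀ t ∈ Icc 0 h, HasDerivAt u (D (x t) (u t)) t)
    (h0 : y 0 - x 0 = u 0) {t : ℝ} (ht : t ∈ Icc 0 h) :
    ‖y t - x t - u t‖ ≤ gronwallBound 0 K (K' * (‖u 0‖ * Real.exp (K * h)) ^ 2) t := by
  have hdist : ∀ t ∈ Icc 0 h, ‖y t - x t‖ ≤ ‖u 0‖ * Real.exp (K * h) := fun t ht ↦ by
    rw [← dist_eq_norm]
    refine (dist_le_of_trajectories_ODE_of_mem (v := fun _ ↦ f) (s := fun _ ↦ S) (K := K)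
      (a := 0) (b := h) (δ := ‖u 0‖)
      (fun _ _ ↦ hlip) (fun s hs ↦ (hy s hs).2.continuousAt.continuousWithinAt)
      (fun s hs ↦ (hy s (Ico_subset_Icc_self hs)).2.hasDerivWithinAt)
      (fun s hs ↦ (hy s (Ico_subset_Icc_self hs)).1)
      (fun s hs ↦ (hx s hs).2.continuousAt.continuousWithinAt)
      (fun s hs ↦ (hx s (Ico_subset_Icc_self hs)).2.hasDerivWithinAt)
      (fun s hs ↦ (hx s (Ico_subset_Icc_self hs)).1)
      (by rw [dist_eq_norm, h0]) t ht).trans ?_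
    rw [sub_zero]
    gcongr
    exact ht.2
  have hderiv : ∀ t ∈ Icc 0 h, HasDerivAt (fun t ↦ y t - x t - u t)
      (f (y t) - f (x t) - D (x t) (u t)) t := fun t ht ↦
    ((hy t ht).2.sub (hx t ht).2).sub (hu t ht)
  have := norm_le_gronwallBound_of_norm_deriv_right_le (f := fun t ↦ y t - x t - u t)
    (f' := fun t ↦ f (y t) - f (x t) - D (x t) (u t)) (δ := 0) (K := K)
    (ε := K' * (‖u 0‖ * Real.exp (K * h)) ^ 2) (a := 0) (b := h)
    (fun s hs ↦ (hderiv s hs).continuousAt.continuousWithinAt)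
    (fun s hs ↦ (hderiv s (Ico_subset_Icc_self hs)).hasDerivWithinAt)
    (by simp [h0]) (fun s hs ↦ ?_) t ht
  · rwa [sub_zero] at this
  · replace hs := Ico_subset_Icc_self hs
    -- The error satisfies its own linear equation, forced by the Taylor remainder, which is
    -- quadratic in the initial displacement.
    have hsplit : f (y s) - f (x s) - D (x s) (u s) =
        D (x s) (y s - x s - u s) + (f (y s) - f (x s) - D (x s) (y s - x s)) := by
      rw [map_sub (D (x s)) (y s - x s)]; abel
    rw [hsplit]
    refine (norm_add_le _ _).trans (add_le_add ?_ ?_)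
    · exact ((D (x s)).le_opNorm _).trans (by gcongr; exact hDK _ (hx s hs).1)
    · refine (norm_taylor_remainder_le hS hf hD (hx s hs).1 (hy s hs).1).trans ?_
      rw [mul_assoc, ← sq]
      gcongr
      exact hdist s hs

/-- With zero initial error the bound is linear in the forcing; this lets the factor `‖u‖ ^ 2` be
pulled out of it. -/
theorem gronwallBound_zero_mul (K ε c t : ℝ) :
    gronwallBound 0 K (ε * c) t = gronwallBound 0 K ε t * c := by
  by_cases hK : K = 0
  · subst hK
    simp only [gronwallBound_K0]; ring
  · simp only [gronwallBound_of_K_ne_0 hK]; ring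

end Analysis

/-! ### The end position as a function of the initial velocity. -/

section Shooting

open Metric
open scoped NNReal

variable {E : Type*} [NormedAddCommGroup E] [NormedSpace ℝ E]

/-- A bound for the position component of a linearised second order equation. -/
theorem norm_fst_comp_sub_smul_id_le {D : ℝ → E × E →L[ℝ] E × E} {A : ℝ → E →L[ℝ] E × E}
    {K : ℝ≥0} {h : ℝ} (hA0 : A 0 = ContinuousLinearMap.inr ℝ E E)
    (hA : ∀ t ∈ Icc 0 h, ‖A t‖ ≤ 2 ∧ HasDerivAt A (D t ∘L A t) t)
    (hD : ∀ t ∈ Icc 0 h, ‖D t‖ ≤ K)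
    (hD1 : ∀ t ∈ Icc 0 h,
      ContinuousLinearMap.fst ℝ E E ∘L D t = ContinuousLinearMap.snd ℝ E E) (hh : 0 ≤ h) :
    ‖ContinuousLinearMap.fst ℝ E E ∘L A h - h • ContinuousLinearMap.id ℝ E‖
      ≤ 2 * K * h * h := by
  have hdiff : ∀ t ∈ Icc 0 h, ‖A t - A 0‖ ≤ 2 * K * h := fun t ht ↦ by
    refine (norm_image_sub_le_of_norm_deriv_le_segment' (C := 2 * K)
      (fun s hs ↦ (hA s hs).2.hasDerivWithinAt) (fun s hs ↦ ?_) t ht).trans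
      (by rw [sub_zero]; gcongr; exact ht.2)
    replace hs := Ico_subset_Icc_self hs
    refine (ContinuousLinearMap.opNorm_comp_le _ _).trans ?_
    have := mul_le_mul (hD s hs) (hA s hs).1 (norm_nonneg _) K.2
    linarith
  -- Since `fst ∘ D = snd` and `snd ∘ inr = id`, the derivative only sees how far `A` has moved from
  -- `A 0`.
  have hder : ∀ t ∈ Icc 0 h, HasDerivAt
      (fun t ↦ ContinuousLinearMap.fst ℝ E E ∘L A t - t • ContinuousLinearMap.id ℝ E)
      (ContinuousLinearMap.snd ℝ E E ∘L (A t - A 0)) t := fun t ht ↦ by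
    have h1 := ((ContinuousLinearMap.compL ℝ E (E × E) E
      (ContinuousLinearMap.fst ℝ E E)).hasFDerivAt.comp_hasDerivAt t (hA t ht).2).sub
      ((hasDerivAt_id t).smul_const (ContinuousLinearMap.id ℝ E))
    refine h1.congr_deriv ?_
    rw [ContinuousLinearMap.compL_apply, ← ContinuousLinearMap.comp_assoc, hD1 t ht, hA0]
    ext v
    simp
  have := norm_image_sub_le_of_norm_deriv_le_segment' (C := 2 * K * h)
    (fun s hs ↦ (hder s hs).hasDerivWithinAt) (fun s hs ↦ ?_) h ⟨hh, le_rfl⟩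
  · have h0 : ContinuousLinearMap.fst ℝ E E ∘L A 0 = 0 := by rw [hA0]; ext v; simp
    simpa [h0] using this
  · refine (ContinuousLinearMap.opNorm_comp_le _ _).trans ?_
    calc _ ≤ 1 * ‖A s - A 0‖ := by
            gcongr; exact ContinuousLinearMap.norm_snd_le ..
      _ ≤ _ := by rw [one_mul]; exact hdiff s (Ico_subset_Icc_self hs)

/-- Solutions of a second order equation `(q, v)' = (v, ξ(q, v))` starting at `(q₀, w)` exist up to
a time which is uniform for `w` in a ball, and for short times `h` the end position depends
differentiably on `w`, with derivative close to `h • id`. -/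
theorem exists_local_flow [FiniteDimensional ℝ E] {f : E × E → E × E} {T : Set E}
    (hT : IsOpen T) (hf : ContDiffOn ℝ ∞ f (T ×ˢ univ))
    (hf1 : ∀ z ∈ T ×ˢ (univ : Set E), (f z).1 = z.2) {q₀ : E} (hq₀ : q₀ ∈ T)
    {R ρ : ℝ} (hρ : 0 < ρ) :
    ∃ h₁ > 0, ∃ γ : E → ℝ → E × E,
      (∀ w ∈ ball (0 : E) R, γ w 0 = (q₀, w) ∧ ∀ t ∈ Ioo (-h₁) h₁,
        HasDerivAt (γ w) (f (γ w t)) t ∧ (γ w t).1 ∈ T ∧ γ w t ∈ closedBall (q₀, w) ρ) ∧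
      ∀ h ∈ Ioo 0 h₁, ∀ w ∈ ball (0 : E) R, ∃ A : E →L[ℝ] E,
        HasFDerivAt (fun w ↦ (γ w h).1) A w ∧
        ‖A - h • ContinuousLinearMap.id ℝ E‖ ≤ h / 2 := by
  obtain ⟨r, hr, hrT⟩ := nhds_basis_closedBall.mem_iff.1 (hT.mem_nhds hq₀)
  set U : Set (E × E) := T ×ˢ univ with hU
  have hUo : IsOpen U := hT.prod isOpen_univ
  -- The margin `1` in the velocity radius leaves room for solutions, which move by at most `a ≤ 1`.
  set S : Set (E × E) := closedBall q₀ r ×ˢ closedBall 0 (R + 1) with hS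
  have hSU : S ⊆ U := prod_mono hrT (subset_univ _)
  have hSc : IsCompact S := (isCompact_closedBall _ _).prod (isCompact_closedBall _ _)
  have hSconv : Convex ℝ S := (convex_closedBall _ _).prod (convex_closedBall _ _)
  have hfd : ∀ z ∈ U, HasFDerivAt f (fderiv ℝ f z) z := fun z hz ↦
    ((hf.contDiffAt (hUo.mem_nhds hz)).differentiableAt (by simp)).hasFDerivAt
  have hDf : ContDiffOn ℝ 1 (fderiv ℝ f) U :=
    (contDiffOn_infty.1 hf 2).fderiv_of_isOpen hUo (by norm_num)
  obtain ⟨K₁, hK₁⟩ := (hf.mono hSU).exists_lipschitzOnWith (by simp) hSconv hSc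
  obtain ⟨K₃, hK₃⟩ := (hDf.mono hSU).exists_lipschitzOnWith (by simp) hSconv hSc
  obtain ⟨K₂, hK₂⟩ := hSc.exists_bound_of_continuousOn (hDf.continuousOn.mono hSU)
  obtain ⟨M₀, hM₀⟩ := hSc.exists_bound_of_continuousOn (hf.continuousOn.mono hSU)
  set K : ℝ≥0 := K₁ + K₂.toNNReal + 1 with hK
  have hKpos : (0 : ℝ) < K := by rw [hK]; push_cast; positivity
  have hlip : LipschitzOnWith K f S := hK₁.weaken (by rw [hK, add_assoc]; exact le_self_add)
  have hDK : ∀ z ∈ S, ‖fderiv ℝ f z‖ ≤ K := fun z hz ↦ by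
    have h1 := hK₂ z hz
    have h2 := Real.le_coe_toNNReal K₂
    have h3 : (0 : ℝ) ≤ K₁ := K₁.2
    rw [hK]; push_cast; linarith
  set M : ℝ≥0 := M₀.toNNReal + 1 with hM
  have hMpos : (0 : ℝ) < M := by rw [hM]; push_cast; positivity
  have hMS : ∀ z ∈ S, ‖f z‖ ≤ M := fun z hz ↦ by
    have h1 := hM₀ z hz
    have h2 := Real.le_coe_toNNReal M₀
    rw [hM]; push_cast; linarith
  set a : ℝ≥0 := (min ρ (min r 1)).toNNReal with ha
  have hapos : 0 < min ρ (min r 1) := lt_min hρ (lt_min hr one_pos)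
  have hacoe : (a : ℝ) = min ρ (min r 1) := Real.coe_toNNReal _ hapos.le
  have haρ : (a : ℝ) ≤ ρ := hacoe ▸ min_le_left _ _
  have har : (a : ℝ) ≤ r := hacoe ▸ (min_le_right _ _).trans (min_le_left _ _)
  have ha1 : (a : ℝ) ≤ 1 := hacoe ▸ (min_le_right _ _).trans (min_le_right _ _)
  have hballS : ∀ w ∈ ball (0 : E) R, closedBall (q₀, w) a ⊆ S := fun w hw z hz ↦ by
    rw [← closedBall_prod_same] at hz
    refine ⟨closedBall_subset_closedBall har hz.1, ?_⟩
    have h1 := mem_closedBall.1 hz.2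
    have h2 := mem_ball.1 hw
    rw [mem_closedBall]
    linarith [dist_triangle z.2 w 0]
  -- The first bound keeps solutions in their balls; the second serves the variational equation and
  -- gives `2 * K * h ≤ 1 / 2`.
  set h₁ : ℝ := min (a / M) (1 / (4 * K)) with hh₁
  have hh₁pos : 0 < h₁ := lt_min (div_pos (hacoe ▸ hapos) hMpos) (by positivity)
  have hMh : M * h₁ ≤ a := by
    have := min_le_left ((a : ℝ) / M) (1 / (4 * K))
    rwa [← hh₁, le_div_iff₀ hMpos, mul_comm] at this
  have hKh : 4 * K * h₁ ≤ 1 := by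
    have := min_le_right ((a : ℝ) / M) (1 / (4 * K))
    rwa [← hh₁, le_div_iff₀ (by positivity), mul_comm] at this
  have hflow : ∀ w : E, ∃ α : ℝ → E × E, w ∈ ball (0 : E) R → α 0 = (q₀, w) ∧
      ∀ t ∈ Ioo (-h₁) h₁, α t ∈ closedBall (q₀, w) a ∧ HasDerivAt α (f (α t)) t := fun w ↦ by
    by_cases hw : w ∈ ball (0 : E) R
    · obtain ⟨α, hα⟩ := exists_solution_mem_closedBall (f := fun _ ↦ f) (x := (q₀, w)) (a := a)
        (M := M) (K := K) hh₁pos.le (fun _ _ ↦ hlip.mono (hballS w hw))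
        (fun _ _ ↦ continuousOn_const) (fun _ _ z hz ↦ hMS z (hballS w hw hz)) hMh
      exact ⟨α, fun _ ↦ hα⟩
    · exact ⟨fun _ ↦ 0, fun h ↦ absurd h hw⟩
  choose γ hγ using hflow
  refine ⟨h₁, hh₁pos, γ, fun w hw ↦ ⟨(hγ w hw).1, fun t ht ↦ ?_⟩, fun h hh w hw ↦ ?_⟩
  · obtain ⟨h2, h3⟩ := (hγ w hw).2 t ht
    exact ⟨h3, (hSU (hballS w hw h2)).1, closedBall_subset_closedBall haρ h2⟩
  have hγS : ∀ w ∈ ball (0 : E) R, ∀ t ∈ Ioo (-h₁) h₁, γ w t ∈ S ∧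
      HasDerivAt (γ w) (f (γ w t)) t := fun w hw t ht ↦
    ⟨hballS w hw ((hγ w hw).2 t ht).1, ((hγ w hw).2 t ht).2⟩
  -- the variational equation is solved on `[-h₂, h₂]` with `h < h₂ < h₁`
  obtain ⟨h₂, hh₂, hh₂₁⟩ := exists_between hh.2
  have hh₂pos : 0 < h₂ := hh.1.trans hh₂
  have hsub : Icc (-h₂) h₂ ⊆ Ioo (-h₁) h₁ := fun t ht ↦
    ⟨by linarith [ht.1], ht.2.trans_lt hh₂₁⟩
  have hsub0 : Icc 0 h ⊆ Ioo (-h₂) h₂ := fun t ht ↦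
    ⟨by linarith [ht.1], ht.2.trans_lt hh₂⟩
  have hsub1 : Icc 0 h ⊆ Ioo (-h₁) h₁ := hsub0.trans (Ioo_subset_Icc_self.trans hsub)
  obtain ⟨A, hA0, hA⟩ := exists_linear_solution (A₀ := ContinuousLinearMap.inr ℝ E E)
    (D := fun t ↦ fderiv ℝ f (γ w t)) (K := K) hh₂pos.le
    (ContinuousLinearMap.norm_inr_le_one ℝ E E)
    (hDf.continuousOn.comp (fun t ht ↦ (hγS w hw t (hsub ht)).2.continuousAt.continuousWithinAt)
      fun t ht ↦ hSU (hγS w hw t (hsub ht)).1)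
    (fun t ht ↦ hDK _ (hγS w hw t (hsub ht)).1)
    (by nlinarith)
  refine ⟨ContinuousLinearMap.fst ℝ E E ∘L A h, ?_, ?_⟩
  · have hsmall : HasFDerivAt (fun w ↦ γ w h) (A h) w := by
      rw [hasFDerivAt_iff_isLittleO_nhds_zero]
      set c : ℝ := gronwallBound 0 K (K₃ * Real.exp (K * h) ^ 2) h with hc
      have hO : (fun u ↦ γ (w + u) h - γ w h - A h u) =O[𝓝 0] fun u ↦ ‖u‖ ^ 2 := by
        refine Asymptotics.IsBigO.of_bound c ?_
        have hcont : Filter.Tendsto (fun u ↦ w + u) (𝓝 0) (𝓝 w) := by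
          simpa using (continuous_const_add w).tendsto 0
        filter_upwards [hcont (isOpen_ball.mem_nhds hw)] with u hu
        have h1 := norm_sub_linearization_le (K := K) (K' := K₃) (f := f) hSconv
          (fun z hz ↦ (hfd z (hSU hz)).hasFDerivWithinAt) hlip hDK hK₃ (x := γ w) (y := γ (w + u))
          (u := fun t ↦ A t u) (h := h)
          (fun t ht ↦ hγS w hw t (hsub1 ht)) (fun t ht ↦ hγS _ hu t (hsub1 ht))
          (fun t ht ↦ (hA t (hsub0 ht)).2.clm_apply (hasDerivAt_const t u) |>.congr_deriv
            (by simp))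
          (by simp [hA0, (hγ w hw).1, (hγ (w + u) hu).1]) (t := h) ⟨hh.1.le, le_rfl⟩
        have h2 : ‖A 0 u‖ = ‖u‖ := by simp [hA0, Prod.norm_def]
        rw [h2, mul_pow, mul_comm (‖u‖ ^ 2), ← mul_assoc, gronwallBound_zero_mul] at h1
        simpa using h1
      refine hO.trans_isLittleO ?_
      have := Asymptotics.isLittleO_norm_pow_id (E' := E) (n := 2) one_lt_two
      exact this
    exact (ContinuousLinearMap.fst ℝ E E).hasFDerivAt.comp w hsmall
  · refine (norm_fst_comp_sub_smul_id_le (D := fun t ↦ fderiv ℝ f (γ w t)) (K := K) hA0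
      (fun t ht ↦ hA t (hsub0 ht)) (fun t ht ↦ hDK _ (hγS w hw t (hsub1 ht)).1)
      (fun t ht ↦ ?_) hh.1.le).trans ?_
    · have hz := hSU (hγS w hw t (hsub1 ht)).1
      have h1 := (ContinuousLinearMap.fst ℝ E E).hasFDerivAt.comp _ (hfd _ hz)
      -- The first component of `f` agrees with `snd` on an open set, so differentiating gives `fst
      -- ∘ Df = snd`.
      have h2 : HasFDerivAt (fun z ↦ (f z).1) (ContinuousLinearMap.snd ℝ E E) (γ w t) :=
        (ContinuousLinearMap.snd ℝ E E).hasFDerivAt.congr_of_eventuallyEq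
          (Filter.eventuallyEq_of_mem (hUo.mem_nhds hz) hf1)
      exact h1.unique h2
    · have h1 : 2 * K * h ≤ 1 / 2 := by nlinarith [hh.2]
      nlinarith [hh.1]

end Shooting

/-! ### Solving the shooting equation by contraction. -/

section FixedPoint

open Metric
open scoped NNReal

variable {E : Type*} [NormedAddCommGroup E] [NormedSpace ℝ E]

/-- A map of the unit ball whose derivative is close to `h • id` and which is close to
`w ↦ q₀ + h • w` takes the value `q₀` exactly once. -/
theorem exists_unique_preimage_of_fderiv_near_smul_id [CompleteSpace E] {S : E → E} {q₀ : E}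
    {h : ℝ} (hh : 0 < h)
    (hS : ∀ w ∈ closedBall (0 : E) 1, ∃ A : E →L[ℝ] E,
      HasFDerivAt S A w ∧ ‖A - h • ContinuousLinearMap.id ℝ E‖ ≤ h / 2)
    (hS0 : ∀ w ∈ closedBall (0 : E) 1, ‖S w - q₀ - h • w‖ ≤ h / 2) :
    ∃ w, ‖w‖ ≤ 1 / 2 ∧ S w = q₀ ∧ ∀ w' ∈ closedBall (0 : E) 1, S w' = q₀ → w' = w := by
  choose! A hA hAh using hS
  set B : Set E := closedBall 0 1 with hB
  -- Newton's map with the exact derivative replaced by `h • id`; both hypotheses, divided by `h`,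
  -- yield the constant `1 / 2`.
  set g : E → E := fun w ↦ w - h⁻¹ • (S w - q₀) with hg
  have hgS : ∀ w, g w = w ↔ S w = q₀ := fun w ↦ by
    simp [hg, hh.ne', sub_eq_zero]
  have hgle : ∀ w ∈ B, ‖g w‖ ≤ 1 / 2 := fun w hw ↦ by
    have h1 : g w = -(h⁻¹ • (S w - q₀ - h • w)) := by
      simp only [hg]
      rw [smul_sub _ (S w - q₀), smul_smul, inv_mul_cancel₀ hh.ne', one_smul]; abel
    rw [h1, norm_neg, norm_smul, norm_inv, Real.norm_of_nonneg hh.le]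
    calc h⁻¹ * ‖S w - q₀ - h • w‖ ≤ h⁻¹ * (h / 2) := by gcongr; exact hS0 w hw
      _ = 1 / 2 := by field_simp
  have hlip : LipschitzOnWith (1 / 2) g B := by
    refine (convex_closedBall _ _).lipschitzOnWith_of_nnnorm_hasFDerivWithin_le
      (f' := fun w ↦ ContinuousLinearMap.id ℝ E - h⁻¹ • A w) (fun w hw ↦
        ((hasFDerivAt_id w).sub (((hA w hw).sub_const q₀).const_smul h⁻¹)).hasFDerivWithinAt)
      fun w hw ↦ ?_
    have h1 : ContinuousLinearMap.id ℝ E - h⁻¹ • A w =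
        -(h⁻¹ • (A w - h • ContinuousLinearMap.id ℝ E)) := by
      rw [smul_sub, smul_smul, inv_mul_cancel₀ hh.ne', one_smul]; abel
    rw [← NNReal.coe_le_coe, coe_nnnorm, h1, norm_neg, norm_smul, norm_inv,
      Real.norm_of_nonneg hh.le]
    calc h⁻¹ * ‖A w - h • ContinuousLinearMap.id ℝ E‖ ≤ h⁻¹ * (h / 2) := by
          gcongr; exact hAh w hw
      _ = _ := by push_cast; field_simp
  have hmaps : MapsTo g B B := fun w hw ↦ by
    rw [hB, mem_closedBall_zero_iff]
    linarith [hgle w hw]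
  have hcontr : ContractingWith (1 / 2) (hmaps.restrict g B B) := by
    refine ⟨?_, hlip.mapsToRestrict hmaps⟩
    rw [← NNReal.coe_lt_coe]; norm_num
  have h0 : (0 : E) ∈ B := mem_closedBall_self zero_le_one
  obtain ⟨w, hw, hfix, -⟩ := hcontr.exists_fixedPoint' isClosed_closedBall.isComplete hmaps h0
    (edist_ne_top _ _)
  refine ⟨w, hfix ▸ hgle w hw, (hgS w).1 hfix, fun w' hw' hSw' ↦ ?_⟩
  exact congrArg Subtype.val
    (hcontr.fixedPoint_unique' (x := ⟨w', hw'⟩) (y := ⟨w, hw⟩)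
      (Subtype.ext ((hgS w').2 hSw')) (Subtype.ext hfix))

/-- The displacement of a solution of a second order equation whose velocity stays close to its
initial velocity. -/
theorem norm_fst_sub_sub_smul_le {f : E × E → E × E} {γ : ℝ → E × E} {q₀ w : E} {h ρ : ℝ}
    (hh : 0 ≤ h) (h0 : γ 0 = (q₀, w))
    (hγ : ∀ t ∈ Icc 0 h, HasDerivAt γ (f (γ t)) t ∧ (f (γ t)).1 = (γ t).2 ∧
      γ t ∈ closedBall (q₀, w) ρ) :
    ‖(γ h).1 - q₀ - h • w‖ ≤ ρ * h := by
  have hder : ∀ t ∈ Icc 0 h, HasDerivAt (fun t ↦ (γ t).1 - t • w) ((γ t).2 - w) t := fun t ht ↦ by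
    have h1 := ((ContinuousLinearMap.fst ℝ E E).hasFDerivAt.comp_hasDerivAt t (hγ t ht).1).sub
      ((hasDerivAt_id t).smul_const w)
    refine h1.congr_deriv ?_
    simp [(hγ t ht).2.1]
  have := norm_image_sub_le_of_norm_deriv_le_segment' (C := ρ)
    (fun s hs ↦ (hder s hs).hasDerivWithinAt) (fun s hs ↦ ?_) h ⟨hh, le_rfl⟩
  · simpa [h0, sub_right_comm] using this
  · have h1 := (hγ s (Ico_subset_Icc_self hs)).2.2
    rw [mem_closedBall_iff_norm] at h1
    exact (norm_snd_le _).trans h1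

end FixedPoint

/-! ### Vector fields and integral curves in charts; uniqueness. -/

section VectorField

variable {E : Type*} [NormedAddCommGroup E] [NormedSpace ℝ E]
  {H : Type*} [TopologicalSpace H] {I : ModelWithCorners ℝ E H}
  {M : Type*} [TopologicalSpace M] [ChartedSpace H M]

/-- The principal part of a vector field in the chart at `x₀`. -/
noncomputable def fieldInChart (I : ModelWithCorners ℝ E H) {M : Type*} [TopologicalSpace M]
    [ChartedSpace H M] (v : (x : M) → TangentSpace I x) (x₀ : M) (z : E) : E :=
  mfderiv I 𝓘(ℝ, E) (extChartAt I x₀) ((extChartAt I x₀).symm z) (v ((extChartAt I x₀).symm z))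

/-- On fibres the tangent trivialization at `x₀` is the derivative of the chart, so smoothness can
be read off from the smooth section `v`. -/
theorem contDiffOn_fieldInChart [IsManifold I ∞ M] {v : (x : M) → TangentSpace I x}
    (hv : ContMDiff I I.tangent ∞ (fun x ↦ (⟨x, v x⟩ : TangentBundle I M))) (x₀ : M) :
    ContDiffOn ℝ ∞ (fieldInChart I v x₀) (extChartAt I x₀).target := by
  have : IsManifold I 1 M := .of_le (n := ∞) (by simp)
  set e := trivializationAt E (TangentSpace I) x₀
  have h1 : ContMDiffOn I 𝓘(ℝ, E) ∞ (fun x ↦ (e (⟨x, v x⟩ : TangentBundle I M)).2)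
      (chartAt H x₀).source :=
    ((e.contMDiffOn_iff (f := fun x ↦ (⟨x, v x⟩ : TangentBundle I M))
      (s := (chartAt H x₀).source) (fun x hx ↦ by
        simpa [e, FiberBundle.mem_trivializationAt_proj_source, e.mem_source] using hx)).1
      hv.contMDiffOn).2
  have h2 := h1.comp (contMDiffOn_extChartAt_symm (n := ∞) (I := I) x₀) (fun z hz ↦ by
    rw [mem_preimage, ← extChartAt_source I]; exact (extChartAt I x₀).map_target hz)
  rw [contMDiffOn_iff_contDiffOn] at h2
  refine h2.congr fun z hz ↦ ?_
  have hx : (extChartAt I x₀).symm z ∈ (chartAt H x₀).source := by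
    rw [← extChartAt_source I]; exact (extChartAt I x₀).map_target hz
  have h3 : e.continuousLinearMapAt ℝ _ (v ((extChartAt I x₀).symm z)) =
      (e (⟨_, v ((extChartAt I x₀).symm z)⟩ : TangentBundle I M)).2 := by
    rw [Bundle.Trivialization.continuousLinearMapAt_apply, e.linearMapAt_apply,
      if_pos (by simpa [e] using hx)]
  exact (DFunLike.congr_fun (TangentBundle.continuousLinearMapAt_trivializationAt hx).symm _).trans
    h3

theorem comp_toSpanSingleton_eq_smulRight {F G : Type*} [NormedAddCommGroup F] [NormedSpace ℝ F]
    [NormedAddCommGroup G] [NormedSpace ℝ G] (L : F →L[ℝ] G) {w : F} {u : G} (h : L w = u) :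
    L ∘L ContinuousLinearMap.toSpanSingleton ℝ w = (1 : ℝ →L[ℝ] ℝ).smulRight u := by
  ext; simp [h]

/-- A solution of the equation in the chart gives an integral curve on the manifold. -/
theorem isMIntegralCurveOn_extChartAt_symm_comp [IsManifold I 1 M] [I.Boundaryless]
    {v : (x : M) → TangentSpace I x} {x₀ : M} {z : ℝ → E} {J : Set ℝ}
    (hz : ∀ t ∈ J, z t ∈ (extChartAt I x₀).target)
    (hz' : ∀ t ∈ J, HasDerivAt z (fieldInChart I v x₀ (z t)) t) :
    IsMIntegralCurveOn (fun t ↦ (extChartAt I x₀).symm (z t)) v J := fun t ht ↦ by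
  have h1 := (mdifferentiableWithinAt_extChartAt_symm (hz t ht)).hasMFDerivWithinAt
  rw [I.range_eq_univ, hasMFDerivWithinAt_univ] at h1
  have h2 := h1.comp t (hz' t ht).hasFDerivAt.hasMFDerivAt
  refine (h2.congr_mfderiv ?_).hasMFDerivWithinAt
  have h3 := mfderivWithin_extChartAt_symm_comp_mfderiv_extChartAt (I := I) (hz t ht)
  have h4 := DFunLike.congr_fun h3 (v ((extChartAt I x₀).symm (z t)))
  rw [I.range_eq_univ] at h4
  exact comp_toSpanSingleton_eq_smulRight (F := E) (G := E) _ h4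

/-- Uniqueness of integral curves on a compact interval starting at the initial time. -/
theorem isMIntegralCurveOn_Icc_eqOn [CompleteSpace E] [IsManifold I 1 M] [T2Space M]
    [BoundarylessManifold I M] {v : (x : M) → TangentSpace I x}
    (hv : ContMDiff I I.tangent 1 (fun x ↦ (⟨x, v x⟩ : TangentBundle I M)))
    {γ γ' : ℝ → M} {a b h : ℝ} (ha : a < 0) (hh : 0 < h) (hb : h < b)
    (hγ : IsMIntegralCurveOn γ v (Ioo a b)) (hγ' : IsMIntegralCurveOn γ' v (Icc 0 h))
    (h0 : γ' 0 = γ 0) : EqOn γ' γ (Icc 0 h) := by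
  classical
  -- Gluing the past of `γ` to `γ'` gives an integral curve on an open interval containing `0`,
  -- where two-sided uniqueness applies.
  set β : ℝ → M := fun t ↦ if t < 0 then γ t else γ' t with hβ
  have hβneg : EqOn β γ (Ioc a 0) := fun t ht ↦ by
    rcases ht.2.lt_or_eq with h1 | h1
    · simp [hβ, h1]
    · simp [hβ, h1, h0]
  have hβpos : EqOn β γ' (Ico 0 h) := fun t ht ↦ by simp [hβ, ht.1.not_gt]
  have hl : ∀ t ∈ Ioc a 0, HasMFDerivWithinAt 𝓘(ℝ, ℝ) I β (Ioc a 0) t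
      ((1 : ℝ →L[ℝ] ℝ).smulRight (v (β t))) := fun t ht ↦ by
    have h1 := (hγ t ⟨ht.1, ht.2.trans_lt (hh.trans hb)⟩).mono
      (fun s hs ↦ ⟨hs.1, hs.2.trans_lt (hh.trans hb)⟩ : Ioc a 0 ⊆ Ioo a b)
    have h2 := h1.congr_of_eventuallyEq (Filter.eventuallyEq_of_mem self_mem_nhdsWithin hβneg)
      (hβneg ht)
    rw [hβneg ht]
    exact h2
  have hr : ∀ t ∈ Ico 0 h, HasMFDerivWithinAt 𝓘(ℝ, ℝ) I β (Ico 0 h) t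
      ((1 : ℝ →L[ℝ] ℝ).smulRight (v (β t))) := fun t ht ↦ by
    have h1 := (hγ' t (Ico_subset_Icc_self ht)).mono Ico_subset_Icc_self
    have h2 := h1.congr_of_eventuallyEq (Filter.eventuallyEq_of_mem self_mem_nhdsWithin hβpos)
      (hβpos ht)
    rw [hβpos ht]
    exact h2
  have hβint : IsMIntegralCurveOn β v (Ioo a h) := fun t ht ↦ by
    rcases lt_trichotomy t 0 with h1 | h1 | h1
    · exact ((hl t ⟨ht.1, h1.le⟩).hasMFDerivAt (Ioc_mem_nhds ht.1 h1)).hasMFDerivWithinAt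
    · subst h1
      refine ((hl 0 ⟨ha, le_rfl⟩).union (hr 0 ⟨le_rfl, hh⟩)).mono fun s hs ↦ ?_
      rcases le_total s 0 with h2 | h2
      · exact Or.inl ⟨hs.1, h2⟩
      · exact Or.inr ⟨h2, hs.2⟩
    · exact ((hr t ⟨h1.le, ht.2⟩).hasMFDerivAt (Ico_mem_nhds h1 ht.2)).hasMFDerivWithinAt
  have heq : EqOn β γ (Ioo a h) :=
    isMIntegralCurveOn_Ioo_eqOn_of_contMDiff_boundaryless (t₀ := 0) ⟨ha, hh⟩ hv hβint
      (hγ.mono (Ioo_subset_Ioo_right hb.le)) (hβneg ⟨ha, le_rfl⟩)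
  have hIoo : EqOn γ' γ (Ioo 0 h) := fun t ht ↦ by
    rw [← heq ⟨ha.trans ht.1, ht.2⟩, hβpos ⟨ht.1.le, ht.2⟩]
  -- The endpoints are reached by continuity.
  refine hIoo.of_subset_closure hγ'.continuousOn (hγ.continuousOn.mono fun t ht ↦
    ⟨ha.trans_le ht.1, ht.2.trans_lt hb⟩) Ioo_subset_Icc_self ?_
  rw [closure_Ioo hh.ne]

end VectorField

/-- The tangent bundle of a Hausdorff manifold is Hausdorff. -/
theorem t2Space_tangentBundle {E : Type*} [NormedAddCommGroup E] [NormedSpace ℝ E]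
    {H : Type*} [TopologicalSpace H] {I : ModelWithCorners ℝ E H}
    {M : Type*} [TopologicalSpace M] [ChartedSpace H M] [IsManifold I 1 M] [T2Space M] :
    T2Space (TangentBundle I M) := by
  have hπ : Continuous (Bundle.TotalSpace.proj : TangentBundle I M → M) :=
    FiberBundle.continuous_proj E (TangentSpace I)
  refine ⟨fun p q hpq ↦ ?_⟩
  by_cases h : p.proj = q.proj
  · set e := trivializationAt E (TangentSpace I : M → Type _) p.proj
    have hp : p ∈ e.source := FiberBundle.mem_trivializationAt_proj_source
    have hq : q ∈ e.source := by
      rw [e.mem_source, ← h]; exact FiberBundle.mem_baseSet_trivializationAt' p.proj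
    -- Distinct vectors over one point differ in the fibre coordinate of a single trivialization.
    have hne : (e p).2 ≠ (e q).2 := fun h2 ↦ hpq <| e.injOn hp hq <| Prod.ext
      ((e.coe_fst hp).trans (h.trans (e.coe_fst hq).symm)) h2
    obtain ⟨u, v, hu, hv, hpu, hqv, huv⟩ := t2_separation hne
    have hc : ContinuousOn (fun x ↦ (e x).2) e.source :=
      continuous_snd.comp_continuousOn e.continuousOn
    refine ⟨_, _, hc.isOpen_inter_preimage e.open_source hu,
      hc.isOpen_inter_preimage e.open_source hv, ⟨hp, hpu⟩, ⟨hq, hqv⟩, ?_⟩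
    exact (huv.preimage _).mono inter_subset_right inter_subset_right
  · obtain ⟨u, v, hu, hv, hpu, hqv, huv⟩ := t2_separation h
    exact ⟨_, _, hu.preimage hπ, hv.preimage hπ, hpu, hqv, huv.preimage _⟩

/-! ### Bundle charts of the tangent bundle. -/

section TangentChart

variable {E : Type*} [NormedAddCommGroup E] [NormedSpace ℝ E]
  {Q : Type*} [TopologicalSpace Q] [ChartedSpace E Q] [IsManifold 𝓘(ℝ, E) ∞ Q]

theorem extChartAt_tangentBundle_target (p : TangentBundle 𝓘(ℝ, E) Q) :
    (extChartAt 𝓘(ℝ, E).tangent p).target = (extChartAt 𝓘(ℝ, E) p.proj).target ×ˢ univ := by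
  ext z
  have h1 := TangentBundle.mem_chart_target_iff (I := 𝓘(ℝ, E)) (M := Q) z p
  simp [extChartAt, OpenPartialHomeomorph.extend]
  exact h1

theorem extChartAt_tangentBundle_snd {p x : TangentBundle 𝓘(ℝ, E) Q}
    (hx : x.proj ∈ (chartAt E p.proj).source) :
    (extChartAt 𝓘(ℝ, E).tangent p x).2 =
      mfderiv 𝓘(ℝ, E) 𝓘(ℝ, E) (extChartAt 𝓘(ℝ, E) p.proj) x.proj x.snd := by
  have : IsManifold 𝓘(ℝ, E) 1 Q := .of_le (n := ∞) (by simp)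
  set e := trivializationAt E (TangentSpace 𝓘(ℝ, E) : Q → Type _) p.proj
  have h3 : e.continuousLinearMapAt ℝ x.proj x.snd = (e x).2 := by
    rw [Bundle.Trivialization.continuousLinearMapAt_apply, e.linearMapAt_apply,
      if_pos (by simpa [e] using hx)]
  exact h3.symm.trans
    (DFunLike.congr_fun (TangentBundle.continuousLinearMapAt_trivializationAt hx) _)

/-- The derivative of a chart at its own centre is the identity of the model space. -/
theorem extChartAt_tangentBundle_apply_self (q : Q) (u w : TangentSpace 𝓘(ℝ, E) q) :
    extChartAt 𝓘(ℝ, E).tangent (⟨q, u⟩ : TangentBundle 𝓘(ℝ, E) Q) ⟨q, w⟩ =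
      (extChartAt 𝓘(ℝ, E) q q, (w : E)) := by
  have : IsManifold 𝓘(ℝ, E) 1 Q := .of_le (n := ∞) (by simp)
  refine Prod.ext rfl ?_
  refine (extChartAt_tangentBundle_snd (p := ⟨q, u⟩) (x := ⟨q, w⟩) (mem_chart_source E q)).trans ?_
  exact DFunLike.congr_fun (mfderiv_extChartAt_self (I := 𝓘(ℝ, E)) (x := q)) w

/-- In a bundle chart, a second order vector field has the form `(q, v) ↦ (v, ξ(q, v))`. -/
theorem IsSODE.fieldInChart_fst {Γ : TQField E Q} (hΓ : IsSODE Γ) {p : TangentBundle 𝓘(ℝ, E) Q}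
    {z : E × E} (hz : z ∈ (extChartAt 𝓘(ℝ, E).tangent p).target) :
    (fieldInChart 𝓘(ℝ, E).tangent Γ p z : E × E).1 = z.2 := by
  have : IsManifold 𝓘(ℝ, E) 1 Q := .of_le (n := ∞) (by simp)
  set φ := extChartAt 𝓘(ℝ, E).tangent p with hφ
  set c := extChartAt 𝓘(ℝ, E) p.proj with hc
  set x := φ.symm z with hx
  have hxs : x ∈ φ.source := φ.map_target hz
  have hxs' : x ∈ (chartAt (ModelProd E E) p).source := by rwa [hφ, extChartAt_source] at hxs
  have hxc : x.proj ∈ (chartAt E p.proj).source := by simpa using hxs'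
  have hproj : MDifferentiableAt 𝓘(ℝ, E).tangent 𝓘(ℝ, E)
      (fun y : TangentBundle 𝓘(ℝ, E) Q ↦ y.proj) x :=
    (Bundle.contMDiff_proj (n := ∞) (TangentSpace 𝓘(ℝ, E) : Q → Type _)).mdifferentiableAt
      (by simp)
  have h1 := (mdifferentiableAt_extChartAt (I := 𝓘(ℝ, E)) hxc).hasMFDerivAt.comp x
    hproj.hasMFDerivAt
  have h2 : HasMFDerivAt 𝓘(ℝ, E × E) 𝓘(ℝ, E) (Prod.fst : E × E → E) (φ x)
      (ContinuousLinearMap.fst ℝ E E) := (ContinuousLinearMap.fst ℝ E E).hasMFDerivAt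
  have h3 := h2.comp x (mdifferentiableAt_extChartAt (I := 𝓘(ℝ, E).tangent) hxs').hasMFDerivAt
  -- Projecting and then applying the base chart is the same map as applying the bundle chart and
  -- then `fst`; the two chain rules are equated.
  have h4 := DFunLike.congr_fun (hasMFDerivAt_unique h3 h1) (Γ x)
  refine Eq.trans h4 ?_
  refine (congrArg (mfderiv 𝓘(ℝ, E) 𝓘(ℝ, E) c x.proj) (hΓ.second_order x)).trans ?_
  refine (extChartAt_tangentBundle_snd hxc).symm.trans ?_
  exact congrArg Prod.snd (φ.right_inv hz)

end TangentChart

/-! ### Trajectories as projections of integral curves. -/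

section Trajectory

variable {E : Type*} [NormedAddCommGroup E] [NormedSpace ℝ E]
  {Q : Type*} [TopologicalSpace Q] [ChartedSpace E Q] [IsManifold 𝓘(ℝ, E) ∞ Q]

theorem IsSODE.hasMFDerivWithinAt_proj {Γ : TQField E Q} (hΓ : IsSODE Γ)
    {γ : ℝ → TangentBundle 𝓘(ℝ, E) Q} {s : Set ℝ} (hγ : IsMIntegralCurveOn γ Γ s) {t : ℝ}
    (ht : t ∈ s) :
    HasMFDerivWithinAt 𝓘(ℝ, ℝ) 𝓘(ℝ, E) (fun t ↦ (γ t).proj) s t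
      ((1 : ℝ →L[ℝ] ℝ).smulRight ((γ t).snd : E)) := by
  have hproj : MDifferentiableAt 𝓘(ℝ, E).tangent 𝓘(ℝ, E)
      (fun y : TangentBundle 𝓘(ℝ, E) Q ↦ y.proj) (γ t) :=
    (Bundle.contMDiff_proj (n := ∞) (TangentSpace 𝓘(ℝ, E) : Q → Type _)).mdifferentiableAt
      (by simp)
  refine (hproj.hasMFDerivAt.comp_hasMFDerivWithinAt t (hγ t ht)).congr_mfderiv ?_
  refine (congrArg _ ?_).trans (comp_toSpanSingleton_eq_smulRight (F := E × E) (G := E) _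
    (hΓ.second_order (γ t)))
  ext
  exact (one_smul ℝ _).trans (one_smul ℝ _).symm

/-- The tangent lift of the projection of an integral curve is the integral curve. -/
theorem IsSODE.tangentLift_proj {Γ : TQField E Q} (hΓ : IsSODE Γ)
    {γ : ℝ → TangentBundle 𝓘(ℝ, E) Q} {s : Set ℝ} (hs : UniqueDiffOn ℝ s)
    (hγ : IsMIntegralCurveOn γ Γ s) : EqOn (tangentLift E s fun t ↦ (γ t).proj) γ s :=
  fun t ht ↦ by
    have h1 := (hΓ.hasMFDerivWithinAt_proj hγ ht).mfderivWithin (hs t ht).uniqueMDiffWithinAt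
    refine Bundle.TotalSpace.ext rfl (heq_of_eq ?_)
    refine (DFunLike.congr_fun h1 (1 : ℝ)).trans ?_
    exact one_smul ℝ ((γ t).snd : E)

theorem IsSODE.isTrajectoryOn_proj {Γ : TQField E Q} (hΓ : IsSODE Γ)
    {γ : ℝ → TangentBundle 𝓘(ℝ, E) Q} {s : Set ℝ} (hs : UniqueDiffOn ℝ s)
    (hγ : IsMIntegralCurveOn γ Γ s) : IsTrajectoryOn Γ (fun t ↦ (γ t).proj) s where
  mdifferentiableOn t ht := (hΓ.hasMFDerivWithinAt_proj hγ ht).mdifferentiableWithinAt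
  integralCurve t ht := by
    have heq := hΓ.tangentLift_proj hs hγ
    rw [heq ht]
    exact (hγ t ht).congr_of_eventuallyEq
      (Filter.eventuallyEq_of_mem self_mem_nhdsWithin heq) (heq ht)

variable [CompleteSpace E] [T2Space Q]

/-- The flow is given by any integral curve on an open interval around the initial time. -/
theorem IsSODE.flow_eq {Γ : TQField E Q} (hΓ : IsSODE Γ) {γ : ℝ → TangentBundle 𝓘(ℝ, E) Q}
    {p : TangentBundle 𝓘(ℝ, E) Q} {a b t : ℝ} (ha : a < 0) (ht : t ∈ Ioo 0 b) (h0 : γ 0 = p)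
    (hγ : IsMIntegralCurveOn γ Γ (Ioo a b)) :
    (t, p) ∈ flowDomain Γ ∧ flow Γ t p = γ t := by
  have : IsManifold 𝓘(ℝ, E) 1 Q := .of_le (n := ∞) (by simp)
  have : T2Space (TangentBundle 𝓘(ℝ, E) Q) := t2Space_tangentBundle
  have hmem : (t, p) ∈ flowDomain Γ := ⟨γ, Ioo a b, isOpen_Ioo, ordConnected_Ioo,
    ⟨ha, ht.1.trans ht.2⟩, ⟨ha.trans ht.1, ht.2⟩, h0, hγ⟩
  refine ⟨hmem, ?_⟩
  rw [flow, dif_pos hmem]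
  -- The curve chosen in `flow` is arbitrary, but its interval contains `[0, t]`, where uniqueness
  -- forces it to equal `γ`.
  obtain ⟨J, -, hJc, hJ0, hJt, hδ0, hδ⟩ := hmem.choose_spec
  exact isMIntegralCurveOn_Icc_eqOn (hΓ.smooth.of_le (by simp)) ha ht.1 ht.2 hγ
    (hδ.mono (hJc.out hJ0 hJt)) (hδ0.trans h0.symm) ⟨ht.1.le, le_rfl⟩

end Trajectory

/-! ### Existence of loops and the differential of the exponential map. -/

section Loops

open Metric

variable {E : Type*} [NormedAddCommGroup E] [NormedSpace ℝ E]
  {Q : Type*} [TopologicalSpace Q] [ChartedSpace E Q] [IsManifold 𝓘(ℝ, E) ∞ Q]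

theorem extChartAt_tangentBundle_symm_apply_self (q : Q) (u : TangentSpace 𝓘(ℝ, E) q) (w : E) :
    (extChartAt 𝓘(ℝ, E).tangent (⟨q, u⟩ : TangentBundle 𝓘(ℝ, E) Q)).symm
      (extChartAt 𝓘(ℝ, E) q q, w) = ⟨q, w⟩ := by
  refine (congrArg (extChartAt 𝓘(ℝ, E).tangent (⟨q, u⟩ : TangentBundle 𝓘(ℝ, E) Q)).symm
    (extChartAt_tangentBundle_apply_self q u w).symm).trans (PartialEquiv.left_inv _ ?_)
  rw [extChartAt_source, TangentBundle.mem_chart_source_iff]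
  exact mem_chart_source E q

/-- The initial velocities of a loop family are bounded. -/
theorem IsLoopFamily.exists_mem_ball [T2Space Q] {Γ : TQField E Q} {q₀ : Q} {h₀ : ℝ}
    {v : ℝ → TangentSpace 𝓘(ℝ, E) q₀} {C : Set Q} {K : Set (TangentBundle 𝓘(ℝ, E) Q)}
    (hv : IsLoopFamily Γ q₀ h₀ v C K) : ∃ R : ℝ, ∀ h ∈ Ioc 0 h₀, v h ∈ ball (0 : E) R := by
  have : IsManifold 𝓘(ℝ, E) 1 Q := .of_le (n := ∞) (by simp)
  set p₀ : TangentBundle 𝓘(ℝ, E) Q := ⟨q₀, 0⟩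
  -- The fibre over `q₀` is closed, so this part of `K` is compact; the bundle chart at `q₀` is
  -- defined on it and bounded there.
  set K₀ := K ∩ (Bundle.TotalSpace.proj : TangentBundle 𝓘(ℝ, E) Q → Q) ⁻¹' {q₀}
  have hπ : Continuous (Bundle.TotalSpace.proj : TangentBundle 𝓘(ℝ, E) Q → Q) :=
    FiberBundle.continuous_proj E (TangentSpace 𝓘(ℝ, E))
  have hcomp : IsCompact K₀ :=
    hv.isCompact_velocities.inter_right (isClosed_singleton.preimage hπ)
  have hcont : ContinuousOn (extChartAt 𝓘(ℝ, E).tangent p₀) K₀ :=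
    (continuousOn_extChartAt p₀).mono fun x hx ↦ by
      rw [extChartAt_source, TangentBundle.mem_chart_source_iff, show x.proj = q₀ from hx.2]
      exact mem_chart_source E q₀
  obtain ⟨B, hB⟩ := hcomp.exists_bound_of_continuousOn hcont
  refine ⟨B + 1, fun h hh ↦ ?_⟩
  have h1 := hB ⟨q₀, v h⟩ ⟨hv.vector_mem h hh, rfl⟩
  rw [extChartAt_tangentBundle_apply_self q₀ 0 (v h)] at h1
  have h2 : ∀ z : E × E, ‖z‖ ≤ B → z.2 ∈ ball (0 : E) (B + 1) := fun z hz ↦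
    mem_ball_zero_iff.2 (((norm_snd_le z).trans hz).trans_lt (lt_add_one B))
  exact h2 _ h1

variable [FiniteDimensional ℝ E]

/-- The flow of a second order equation near a point `q₀` of the base, in a bundle chart. -/
theorem IsSODE.exists_local_flow {Γ : TQField E Q} (hΓ : IsSODE Γ) (q₀ : Q) (R : ℝ) {ρ : ℝ}
    (hρ : 0 < ρ) :
    ∃ h₁ > 0, ∃ γ : E → ℝ → E × E,
      (∀ w ∈ ball (0 : E) R,
        γ w 0 = (extChartAt 𝓘(ℝ, E) q₀ q₀, w) ∧
        (∀ t ∈ Ioo (-h₁) h₁, (γ w t).1 ∈ (extChartAt 𝓘(ℝ, E) q₀).target ∧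
          γ w t ∈ closedBall (extChartAt 𝓘(ℝ, E) q₀ q₀, w) ρ) ∧
        IsMIntegralCurveOn (fun t ↦ (extChartAt 𝓘(ℝ, E).tangent
          (⟨q₀, 0⟩ : TangentBundle 𝓘(ℝ, E) Q)).symm (γ w t)) Γ (Ioo (-h₁) h₁)) ∧
      ∀ h ∈ Ioo 0 h₁, ∀ w ∈ ball (0 : E) R,
        ‖(γ w h).1 - extChartAt 𝓘(ℝ, E) q₀ q₀ - h • w‖ ≤ ρ * h ∧
        ∃ A : E →L[ℝ] E, HasFDerivAt (fun w ↦ (γ w h).1) A w ∧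
          ‖A - h • ContinuousLinearMap.id ℝ E‖ ≤ h / 2 := by
  have : IsManifold 𝓘(ℝ, E).tangent ∞ (TangentBundle 𝓘(ℝ, E) Q) := inferInstance
  have : IsManifold 𝓘(ℝ, E).tangent 1 (TangentBundle 𝓘(ℝ, E) Q) := .of_le (n := ∞) (by simp)
  set p₀ : TangentBundle 𝓘(ℝ, E) Q := ⟨q₀, 0⟩
  set f : E × E → E × E := fieldInChart 𝓘(ℝ, E).tangent Γ p₀
  have htarget := extChartAt_tangentBundle_target p₀
  have hf : ContDiffOn ℝ ∞ f ((extChartAt 𝓘(ℝ, E) q₀).target ×ˢ univ) := by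
    rw [← htarget]
    exact contDiffOn_fieldInChart hΓ.smooth p₀
  have hf1 : ∀ z ∈ (extChartAt 𝓘(ℝ, E) q₀).target ×ˢ (univ : Set E), (f z).1 = z.2 := by
    rw [← htarget]
    exact fun z hz ↦ hΓ.fieldInChart_fst hz
  obtain ⟨h₁, hh₁, γ, hγ, hd⟩ := SODE.exists_local_flow (isOpen_extChartAt_target q₀) hf hf1
    (mem_extChartAt_target q₀) (R := R) hρ
  refine ⟨h₁, hh₁, γ, fun w hw ↦ ⟨(hγ w hw).1, fun t ht ↦ ((hγ w hw).2 t ht).2, ?_⟩,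
    fun h hh w hw ↦ ⟨?_, hd h hh w hw⟩⟩
  · refine isMIntegralCurveOn_extChartAt_symm_comp (fun t ht ↦ ?_)
      fun t ht ↦ ((hγ w hw).2 t ht).1
    rw [htarget]
    exact ⟨((hγ w hw).2 t ht).2.1, mem_univ _⟩
  · refine norm_fst_sub_sub_smul_le (f := f) hh.1.le (hγ w hw).1 fun t ht ↦ ?_
    obtain ⟨h2, h3, h4⟩ := (hγ w hw).2 t ⟨by linarith [ht.1], ht.2.trans_lt hh.2⟩
    exact ⟨h2, hf1 _ ⟨h3, mem_univ _⟩, h4⟩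

variable [T2Space Q]

/-- Short loop trajectories exist. -/
theorem IsSODE.exists_isLoopFamily {Γ : TQField E Q} (hΓ : IsSODE Γ) (q₀ : Q) :
    ∃ (h₀ : ℝ) (v : ℝ → TangentSpace 𝓘(ℝ, E) q₀) (C : Set Q)
      (K : Set (TangentBundle 𝓘(ℝ, E) Q)), IsLoopFamily Γ q₀ h₀ v C K := by
  have : IsManifold 𝓘(ℝ, E) 1 Q := .of_le (n := ∞) (by simp)
  have : T2Space (TangentBundle 𝓘(ℝ, E) Q) := t2Space_tangentBundle
  have : CompleteSpace E := FiniteDimensional.complete ℝ E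
  set c := extChartAt 𝓘(ℝ, E) q₀ with hc
  set φ := extChartAt 𝓘(ℝ, E).tangent (⟨q₀, 0⟩ : TangentBundle 𝓘(ℝ, E) Q) with hφ
  have htarget : φ.target = c.target ×ˢ univ := extChartAt_tangentBundle_target _
  have hproj : ∀ z : E × E, (φ.symm z).proj = c.symm z.1 := fun z ↦ rfl
  have hφq : ∀ w : E, φ.symm (c q₀, w) = ⟨q₀, w⟩ := extChartAt_tangentBundle_symm_apply_self q₀ 0
  have hcq : c.symm (c q₀) = q₀ := c.left_inv (mem_extChartAt_source q₀)
  have hcinj : ∀ x ∈ c.target, c.symm x = q₀ → x = c q₀ := fun x hx h ↦ by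
    rw [← h, c.right_inv hx]
  obtain ⟨r, hr, hrc⟩ := nhds_basis_closedBall.mem_iff.1
    ((isOpen_extChartAt_target (I := 𝓘(ℝ, E)) q₀).mem_nhds (mem_extChartAt_target q₀))
  -- The bound `r` keeps positions in the chart. The bound `1 / 2` meets the contraction hypothesis
  -- and keeps velocities starting with norm at most `1 / 2` in the unit ball.
  set ρ := min r (1 / 2) with hρ
  have hρ0 : 0 < ρ := lt_min hr (by norm_num)
  have hρ2 : ρ ≤ 1 / 2 := min_le_right _ _
  have hρc : closedBall (c q₀) ρ ⊆ c.target :=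
    (closedBall_subset_closedBall (min_le_left _ _)).trans hrc
  obtain ⟨h₁, hh₁, γ, hγ, hd⟩ := hΓ.exists_local_flow q₀ 2 hρ0
  have hball : ∀ w ∈ closedBall (0 : E) 1, w ∈ ball (0 : E) 2 := fun w hw ↦
    closedBall_subset_ball (by norm_num) hw
  have hsol : ∀ h : ℝ, ∃ w : E, h ∈ Ioo 0 h₁ → ‖w‖ ≤ 1 / 2 ∧ (γ w h).1 = c q₀ ∧
      ∀ w' ∈ closedBall (0 : E) 1, (γ w' h).1 = c q₀ → w' = w := fun h ↦ by
    by_cases hh : h ∈ Ioo 0 h₁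
    · obtain ⟨w, hw⟩ := exists_unique_preimage_of_fderiv_near_smul_id (S := fun w ↦ (γ w h).1)
        (q₀ := c q₀) hh.1 (fun w hw ↦ (hd h hh w (hball w hw)).2)
        (fun w hw ↦ (hd h hh w (hball w hw)).1.trans (by nlinarith [hh.1]))
      exact ⟨w, fun _ ↦ hw⟩
    · exact ⟨0, fun h ↦ absurd h hh⟩
  choose v hv using hsol
  have hIoo : ∀ h ∈ Ioc 0 (h₁ / 2), h ∈ Ioo 0 h₁ := fun h hh ↦ ⟨hh.1, by linarith [hh.2]⟩
  have hv1 : ∀ h ∈ Ioc 0 (h₁ / 2), v h ∈ closedBall (0 : E) 1 := fun h hh ↦ by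
    rw [mem_closedBall_zero_iff]; linarith [(hv h (hIoo h hh)).1]
  set K : Set (TangentBundle 𝓘(ℝ, E) Q) :=
    φ.symm '' (closedBall (c q₀) ρ ×ˢ closedBall (0 : E) 1) with hK
  refine ⟨h₁ / 2, v, c.symm '' closedBall (c q₀) ρ, K, half_pos hh₁, ?_, ?_, ?_, ?_, ?_⟩
  · exact (isCompact_closedBall _ _).image_of_continuousOn
      ((continuousOn_extChartAt_symm q₀).mono hρc)
  · refine ((isCompact_closedBall _ _).prod (isCompact_closedBall _ _)).image_of_continuousOn
      ((continuousOn_extChartAt_symm _).mono ?_)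
    rw [← hφ, htarget]
    exact prod_mono hρc (subset_univ _)
  · exact ⟨c q₀, mem_closedBall_self hρ0.le, hcq⟩
  · exact fun h hh ↦ ⟨(c q₀, v h), ⟨mem_closedBall_self hρ0.le, hv1 h hh⟩, hφq _⟩
  intro h hh
  have hIcc : Icc 0 h ⊆ Ioo (-h₁) h₁ := fun t ht ↦
    ⟨by linarith [ht.1], ht.2.trans_lt (hIoo h hh).2⟩
  obtain ⟨hvn, hvh, hvu⟩ := hv h (hIoo h hh)
  have hγball := fun t ht ↦ ((hγ (v h) (hball _ (hv1 h hh))).2.1 t ht).2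
  have hγ1 : ∀ t ∈ Icc 0 h, (γ (v h) t).1 ∈ closedBall (c q₀) ρ := fun t ht ↦ by
    have := hγball t (hIcc ht)
    rw [← closedBall_prod_same] at this
    exact this.1
  have hγ2 : ∀ t ∈ Icc 0 h, (γ (v h) t).2 ∈ closedBall (0 : E) 1 := fun t ht ↦ by
    have := hγball t (hIcc ht)
    rw [← closedBall_prod_same] at this
    have h2 := mem_closedBall.1 this.2
    rw [mem_closedBall]
    have h3 := dist_triangle (γ (v h) t).2 (v h) 0
    rw [dist_zero_right (v h)] at h3
    linarith
  have hu : UniqueDiffOn ℝ (Icc 0 h) := uniqueDiffOn_Icc hh.1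
  have hint := (hγ (v h) (hball _ (hv1 h hh))).2.2.mono hIcc
  have hlift := hΓ.tangentLift_proj hu hint
  have h00 : (0 : ℝ) ∈ Icc 0 h := ⟨le_rfl, hh.1.le⟩
  have hstart : φ.symm (γ (v h) 0) = ⟨q₀, v h⟩ := by
    rw [(hγ (v h) (hball _ (hv1 h hh))).1, hφq]
  refine ⟨fun t ↦ (φ.symm (γ (v h) t)).proj, ⟨hΓ.isTrajectoryOn_proj hu hint, ?_, ?_, ?_, ?_⟩,
    (hlift h00).trans hstart, fun σ hσ ↦ ?_⟩
  · exact fun t ht ↦ ⟨_, hγ1 t ht, (hproj _).symm⟩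
  · exact congrArg Bundle.TotalSpace.proj hstart
  · rw [hproj, hvh, hcq]
  · intro t ht
    rw [hlift ht]
    exact ⟨_, ⟨hγ1 t ht, hγ2 t ht⟩, rfl⟩
  -- Membership of the initial velocity in `K` puts `w` in the unit ball, where shooting has a
  -- unique solution.
  · obtain ⟨⟨x, w⟩, ⟨hx, hw⟩, hxw⟩ := hσ.velocity_mem 0 h00
    have hx0 : x = c q₀ := hcinj x (hρc hx) <|
      (congrArg Bundle.TotalSpace.proj hxw).trans hσ.start
    subst hx0
    obtain ⟨hw0, hwt, hwint⟩ := hγ w (hball w hw)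
    have heq := isMIntegralCurveOn_Icc_eqOn (hΓ.smooth.of_le (by simp)) (neg_lt_zero.2 hh₁) hh.1
      (hIoo h hh).2 hwint hσ.trajectory.integralCurve
      (by rw [← hxw, hw0])
    have hwh : (γ w h).1 = c q₀ := by
      refine hcinj _ (hwt h (hIcc ⟨hh.1.le, le_rfl⟩)).1 ?_
      exact (congrArg Bundle.TotalSpace.proj (heq ⟨hh.1.le, le_rfl⟩)).symm.trans hσ.finish
    rw [← hvu w hw hwh]
    exact fun t ht ↦ congrArg Bundle.TotalSpace.proj (heq ht)

/-- A linear map close to `h • id` is invertible. -/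
theorem exists_equiv_of_norm_sub_smul_id_le {A : E →L[ℝ] E} {h : ℝ} (hh : 0 < h)
    (hA : ‖A - h • ContinuousLinearMap.id ℝ E‖ ≤ h / 2) : ∃ L : E ≃L[ℝ] E, (L : E →L[ℝ] E) = A := by
  have hinj : Function.Injective A.toLinearMap := by
    refine (injective_iff_map_eq_zero _).2 fun w hw ↦ ?_
    have hw' : A w = 0 := hw
    have h1 := (A - h • ContinuousLinearMap.id ℝ E).le_of_opNorm_le hA w
    simp only [sub_apply, smul_apply,
      ContinuousLinearMap.id_apply, hw', zero_sub, norm_neg, norm_smul,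
      Real.norm_of_nonneg hh.le] at h1
    have h2 : ‖w‖ ≤ 0 := by nlinarith [norm_nonneg w]
    exact norm_le_zero_iff.1 h2
  exact ⟨(LinearEquiv.ofInjectiveEndo A.toLinearMap hinj).toContinuousLinearEquiv, by ext; rfl⟩

/-- For short times the exponential map is a local diffeomorphism at the vectors of a bounded
set. -/
theorem IsSODE.exists_expMap_differential {Γ : TQField E Q} (hΓ : IsSODE Γ) (q₀ : Q) (R : ℝ) :
    ∃ h₁ > 0, ∀ h ∈ Ioc 0 h₁, ∀ w ∈ ball (0 : E) R,
      w ∈ expDomain Γ h q₀ ∧ expDomain Γ h q₀ ∈ 𝓝 w ∧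
      (∀ σ : ℝ → Q, IsTrajectoryOn Γ σ (Icc 0 h) →
        tangentLift E (Icc 0 h) σ 0 = ⟨q₀, w⟩ → expMap Γ h q₀ w = σ h) ∧
      ∃ L : E ≃L[ℝ] E, HasMFDerivAt 𝓘(ℝ, E) 𝓘(ℝ, E) (fun w : E ↦ expMap Γ h q₀ w) w
        (L : E →L[ℝ] E) := by
  have : IsManifold 𝓘(ℝ, E) 1 Q := .of_le (n := ∞) (by simp)
  have : T2Space (TangentBundle 𝓘(ℝ, E) Q) := t2Space_tangentBundle
  have : CompleteSpace E := FiniteDimensional.complete ℝ E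
  set c := extChartAt 𝓘(ℝ, E) q₀ with hc
  set φ := extChartAt 𝓘(ℝ, E).tangent (⟨q₀, 0⟩ : TangentBundle 𝓘(ℝ, E) Q) with hφ
  have hφq : ∀ w : E, φ.symm (c q₀, w) = ⟨q₀, w⟩ := extChartAt_tangentBundle_symm_apply_self q₀ 0
  -- Any positive `ρ` would do: the displacement estimate plays no role here.
  obtain ⟨h₁, hh₁, γ, hγ, hd⟩ := hΓ.exists_local_flow q₀ R one_pos
  refine ⟨h₁ / 2, half_pos hh₁, fun h hh w hwb ↦ ?_⟩
  have hIoo : h ∈ Ioo 0 h₁ := ⟨hh.1, by linarith [hh.2]⟩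
  have hflow : ∀ w ∈ ball (0 : E) R, (h, (⟨q₀, w⟩ : TangentBundle 𝓘(ℝ, E) Q)) ∈ flowDomain Γ ∧
      flow Γ h ⟨q₀, w⟩ = φ.symm (γ w h) := fun w hw ↦
    hΓ.flow_eq (neg_lt_zero.2 hh₁) hIoo (by rw [(hγ w hw).1, hφq]) (hγ w hw).2.2
  have hnhds : ball (0 : E) R ∈ 𝓝 w := isOpen_ball.mem_nhds hwb
  refine ⟨(hflow w hwb).1, Filter.mem_of_superset hnhds fun u hu ↦ (hflow u hu).1,
    fun σ hσ hσ0 ↦ ?_, ?_⟩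
  · have heq := isMIntegralCurveOn_Icc_eqOn (hΓ.smooth.of_le (by simp)) (neg_lt_zero.2 hh₁) hh.1
      hIoo.2 (hγ w hwb).2.2 hσ.integralCurve (by rw [hσ0, (hγ w hwb).1, hφq])
    have h1 := heq (x := h) ⟨hh.1.le, le_rfl⟩
    exact (congrArg Bundle.TotalSpace.proj ((hflow w hwb).2.trans h1.symm) :)
  · obtain ⟨A, hA, hAh⟩ := (hd h hIoo w hwb).2
    obtain ⟨LA, hLA⟩ := exists_equiv_of_norm_sub_smul_id_le hh.1 hAh
    have htgt : (γ w h).1 ∈ c.target := ((hγ w hwb).2.1 h ⟨by linarith [hh.1], hIoo.2⟩).1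
    have h1 := (mdifferentiableWithinAt_extChartAt_symm (I := 𝓘(ℝ, E)) htgt).hasMFDerivWithinAt
    -- The end point need not be `q₀`, so the inverse chart contributes a further invertible factor
    -- `LC`.
    obtain ⟨LC, hLC⟩ := isInvertible_mfderivWithin_extChartAt_symm (I := 𝓘(ℝ, E)) htgt
    rw [← hLC, ModelWithCorners.range_eq_univ, hasMFDerivWithinAt_univ] at h1
    have h2 := h1.comp w hA.hasMFDerivAt
    have h3 := h2.congr_of_eventuallyEq (f₁ := fun w : E ↦ expMap Γ h q₀ w)
      (Filter.eventuallyEq_of_mem hnhds fun u hu ↦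
        congrArg Bundle.TotalSpace.proj (hflow u hu).2)
    refine ⟨LA.trans LC, ?_⟩
    refine h3.congr_mfderiv ?_
    rw [← hLA]
    rfl

end Loops

end SODE

theorem theorem2p2
    {E : Type*} [NormedAddCommGroup E] [NormedSpace ℝ E] [FiniteDimensional ℝ E]
    {Q : Type*} [TopologicalSpace Q] [T2Space Q] [ChartedSpace E Q] [IsManifold 𝓘(ℝ, E) ∞ Q]
    (Γ : SODE.TQField E Q) (hΓ : SODE.IsSODE Γ) (q₀ : Q) :
    (∃ (h₀ : ℝ) (v : ℝ → TangentSpace 𝓘(ℝ, E) q₀) (C : Set Q)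
        (K : Set (TangentBundle 𝓘(ℝ, E) Q)), SODE.IsLoopFamily Γ q₀ h₀ v C K) ∧
    ∀ (h₀ : ℝ) (v : ℝ → TangentSpace 𝓘(ℝ, E) q₀) (C : Set Q)
      (K : Set (TangentBundle 𝓘(ℝ, E) Q)), SODE.IsLoopFamily Γ q₀ h₀ v C K →
      ∃ h₁ : ℝ, 0 < h₁ ∧ h₁ ≤ h₀ ∧ ∀ h : ℝ, 0 < h → h ≤ h₁ →
        v h ∈ SODE.expDomain Γ h q₀ ∧
        SODE.expMap Γ h q₀ (v h) = q₀ ∧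
        SODE.expDomain Γ h q₀ ∈ 𝓝 (v h) ∧
        ∃ L : TangentSpace 𝓘(ℝ, E) q₀ ≃L[ℝ] TangentSpace 𝓘(ℝ, E) q₀,
          HasMFDerivAt 𝓘(ℝ, E) 𝓘(ℝ, E) (fun w : E ↦ SODE.expMap Γ h q₀ w) (v h)
            (L : TangentSpace 𝓘(ℝ, E) q₀ →L[ℝ] TangentSpace 𝓘(ℝ, E) q₀) := by
  refine ⟨hΓ.exists_isLoopFamily q₀, fun h₀ v C K hv ↦ ?_⟩
  obtain ⟨R, hR⟩ := hv.exists_mem_ball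
  obtain ⟨h₁, hh₁, H⟩ := hΓ.exists_expMap_differential q₀ R
  refine ⟨min h₀ h₁, lt_min hv.pos hh₁, min_le_left _ _, fun h hh hle ↦ ?_⟩
  have hmem : h ∈ Ioc 0 h₀ := ⟨hh, hle.trans (min_le_left _ _)⟩
  obtain ⟨hdom, hnhds, hexp, L, hL⟩ :=
    H h ⟨hh, hle.trans (min_le_right _ _)⟩ (v h) (hR h hmem)
  obtain ⟨σ, hσ, hσ0, -⟩ := hv.exists_unique h hmem
  exact ⟨hdom, (hexp σ hσ.trajectory hσ0).trans hσ.finish, hnhds, L, hL⟩
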